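/- Let $d\ge 3$ and let $\mathbb S^{d-1}$ be the unit sphere of $\mathbb R^d$ with the uniform probability measure $\mu$. For $\ell\ge 0$ let $\mathcal H_\ell$ be the space of restrictions to $\mathbb S^{d-1}$ of the real homogeneous polynomials $P$ of degree $\ell$ in $d$ variables with $\Delta P=\sum_{i=1}^d \partial^2P/\partial x_i^2=0$, let $N_\ell=\dim\mathcal H_\ell$, and let $(Y_{\ell,i})_{1\le i\le N_\ell}$ be any orthonormal basis of $\mathcal H_\ell$ for the inner product $\langle f,g\rangle=\int_{\mathbb S^{d-1}}fg\,d\mu$. Let $h$ be a real function that is analytic on $[-1,1]$ in the sense that it is the sum of its power series about $0$ there: for every $x\in[-1,1]$, $$h(x)=\sum_{n=0}^\infty \frac{h^{(n)}(0)}{n!}\,x^n$$ with absolute convergence. (This holds, for instance, if $h$ extends to a holomorphic function on a neighbourhood of the closed complex unit disc.) Put $\mathcal K(x,y)=h(\langle x,y\rangle)$ for $x,y\in\mathbb S^{d-1}$. Then for every $\ell\ge0$ the series $$\beta_\ell(h)=\frac{d-2}{2}\sum_{m=0}^\infty\frac{h^{(\ell+2m)}(0)}{2^{\ell+2m}\,m!\,\left(\frac{d-2}{2}\right)_{\ell+m+1}}$$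 converges absolutely, where $(a)_0=1$ and $(a)_k=(a+k-1)(a)_{k-1}$ for $k\ge1$, and for all $x,y\in\mathbb S^{d-1}$ $$\mathcal K(x,y)=\sum_{\ell=0}^\infty\beta_\ell(h)\sum_{i=1}^{N_\ell}Y_{\ell,i}(x)\,Y_{\ell,i}(y),$$ the series over $\ell$ being absolutely convergent. -/

import Mathlib

open MeasureTheory Finset

noncomputable section

/-- The unit sphere `S^{d-1}` of `ℝ^d` with its Euclidean norm. -/
abbrev UnitSphere (d : ℕ) : Type :=
  Metric.sphere (0 : EuclideanSpace ℝ (Fin d)) 1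

/-- The uniform probability measure on `S^{d-1}`: normalised surface measure. -/
def uniformSphere (d : ℕ) : Measure (UnitSphere d) :=
  ((volume : Measure (EuclideanSpace ℝ (Fin d))).toSphere Set.univ)⁻¹ •
    (volume : Measure (EuclideanSpace ℝ (Fin d))).toSphere

/-- The Laplacian `∑ i, ∂²/∂x_i²` on real polynomials in `d` variables. -/
def polyLaplacian (d : ℕ) : MvPolynomial (Fin d) ℝ →ₗ[ℝ] MvPolynomial (Fin d) ℝ :=
  ∑ i : Fin d, (MvPolynomial.pderiv i).toLinearMap ∘ₗ (MvPolynomial.pderiv i).toLinearMap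

/-- Restriction of a polynomial in `d` variables to a function on the sphere. -/
def restrictToSphere (d : ℕ) : MvPolynomial (Fin d) ℝ →ₗ[ℝ] (UnitSphere d → ℝ) :=
  LinearMap.pi fun x : UnitSphere d =>
    (MvPolynomial.aeval (fun i : Fin d => (x : EuclideanSpace ℝ (Fin d)) i)).toLinearMap

/-- The spherical harmonics of degree `l`: restrictions to the sphere of the homogeneous
polynomials of degree `l` with vanishing Laplacian. -/
def sphericalHarmonics (d l : ℕ) : Submodule ℝ (UnitSphere d → ℝ) :=
  (MvPolynomial.homogeneousSubmodule (Fin d) ℝ l ⊓ LinearMap.ker (polyLaplacian d)).map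
    (restrictToSphere d)

/-- The dimension `N_l` of the space of spherical harmonics of degree `l`. -/
def harmonicDim (d l : ℕ) : ℕ :=
  Module.finrank ℝ (sphericalHarmonics d l)

/-- `Y` is an orthonormal basis of the spherical harmonics of degree `l`, for the inner product
`⟨f, g⟩ = ∫ f g` against the uniform probability measure on the sphere. -/
structure IsHarmonicONB (d l : ℕ) (Y : Fin (harmonicDim d l) → UnitSphere d → ℝ) : Prop where
  orthonormal : ∀ i j, ∫ x, Y i x * Y j x ∂(uniformSphere d) = if i = j then 1 else 0
  span_eq : Submodule.span ℝ (Set.range Y) = sphericalHarmonics d l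

/-- The `m`-th term `h^{(l+2m)}(0) / (2^{l+2m} m! ((d-2)/2)_{l+m+1})` of the series in the
coefficient `β_l(h)`; here `(a)_n = a (a+1) ⋯ (a+n-1)` is the Pochhammer symbol. -/
def betaTerm (d : ℕ) (h : ℝ → ℝ) (l m : ℕ) : ℝ :=
  iteratedDeriv (l + 2 * m) h 0 /
    (2 ^ (l + 2 * m) * (Nat.factorial m : ℝ) *
      (ascPochhammer ℝ (l + m + 1)).eval (((d : ℝ) - 2) / 2))

/-- The coefficient `β_l(h) = ((d-2)/2) ∑_m h^{(l+2m)}(0) / (2^{l+2m} m! ((d-2)/2)_{l+m+1})`. -/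
def beta (d : ℕ) (h : ℝ → ℝ) (l : ℕ) : ℝ :=
  ((d : ℝ) - 2) / 2 * ∑' m : ℕ, betaTerm d h l m

/-- `h` is analytic on `[-1,1]` in the sense of being the sum there of its power series about `0`:
for every `x ∈ [-1,1]` the Maclaurin series of `h` converges (absolutely) to `h x`. -/
def AnalyticOnUnitInterval (h : ℝ → ℝ) : Prop :=
  ∀ x ∈ Set.Icc (-1 : ℝ) 1,
    HasSum (fun n : ℕ => iteratedDeriv n h 0 / (Nat.factorial n : ℝ) * x ^ n) (h x)

end

/-! Write `J` for the mean of a polynomial over the sphere. Everything rests on Green's identity `k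
(k + d - 2) J P = J (ΔP)` for `P` homogeneous of degree `k`
(`mul_sphereInt_eq_sphereInt_polyLaplacian`). It is obtained by integrating against `exp (-|x|²)`:
integration by parts and Euler's identity give the analogue on the whole space, and polar
coordinates carry it to the sphere, up to Gamma integrals.

From Green's identity alone, induction on degree gives orthogonality of harmonics of different
degrees and the Funk–Hecke formula `J (⟨·, y⟩ ^ (l + 2m) P) = zonalCoeff d l m * P y` for harmonic
`P` of degree `l` (`map_linForm_pow_mul`). Since homogeneous polynomials split as `∑ |x|^(2m) H_m`
with `H_m` harmonic, this expands `⟨x, y⟩ ^ n` in the kernels `Z_l(x, y) = ∑ i, Y_{l,i}(x)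
Y_{l,i}(y)` with positive coefficients (`inner_pow_eq_sum`).

Inserting this in the power series of `h` and exchanging the sums over `n` and `l` yields the claim.
The exchange is legitimate because positivity, together with the expansion at `x = y`, bounds the
absolute sum for each `n` by `1` (`sum_zonalCoeff_mul_abs_le_one`). -/

open MvPolynomial in
theorem polyLaplacian_apply (d : ℕ) (P : MvPolynomial (Fin d) ℝ) :
    polyLaplacian d P = ∑ i, pderiv i (pderiv i P) := by
  simp [polyLaplacian]

/-! ### Laplacian, harmonic decomposition and powers of linear forms. -/

namespace MvPolynomial

variable {d : ℕ}

/-- The product rule for the Laplacian. -/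
theorem polyLaplacian_mul (P Q : MvPolynomial (Fin d) ℝ) :
    polyLaplacian d (P * Q) = polyLaplacian d P * Q
      + 2 * ∑ i, pderiv i P * pderiv i Q + P * polyLaplacian d Q := by
  simp only [polyLaplacian_apply, pderiv_mul, map_add, Finset.sum_mul, Finset.mul_sum,
    ← Finset.sum_add_distrib]
  exact Finset.sum_congr rfl fun i _ => by ring

theorem pderiv_comm (i j : Fin d) (P : MvPolynomial (Fin d) ℝ) :
    pderiv i (pderiv j P) = pderiv j (pderiv i P) := by
  have h : ⁅pderiv (R := ℝ) i, pderiv (R := ℝ) j⁆ = 0 := by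
    ext k
    simp [Derivation.commutator_apply, pderiv_X, Pi.single_apply, apply_ite]
  have := congrArg (fun D => D P) h
  simpa [Derivation.commutator_apply, sub_eq_zero] using this

theorem polyLaplacian_pderiv (i : Fin d) (P : MvPolynomial (Fin d) ℝ) :
    polyLaplacian d (pderiv i P) = pderiv i (polyLaplacian d P) := by
  simp only [polyLaplacian_apply, map_sum]
  exact Finset.sum_congr rfl fun j _ => by rw [pderiv_comm j i, pderiv_comm j i]

theorem IsHomogeneous.pderiv_pderiv {P : MvPolynomial (Fin d) ℝ} {k : ℕ}
    (hP : P.IsHomogeneous k) (i : Fin d) : (pderiv i (pderiv i P)).IsHomogeneous (k - 2) :=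
  hP.pderiv.pderiv

theorem IsHomogeneous.polyLaplacian {P : MvPolynomial (Fin d) ℝ} {k : ℕ}
    (hP : P.IsHomogeneous k) : (polyLaplacian d P).IsHomogeneous (k - 2) := by
  rw [polyLaplacian_apply]
  exact IsHomogeneous.sum _ _ _ fun i _ => hP.pderiv_pderiv i

theorem IsHomogeneous.pderiv_eq_zero {P : MvPolynomial (Fin d) ℝ}
    (hP : P.IsHomogeneous 0) (i : Fin d) : pderiv i P = 0 := by
  rw [← totalDegree_zero_iff_isHomogeneous, totalDegree_eq_zero_iff_eq_C] at hP
  rw [hP, pderiv_C]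

theorem IsHomogeneous.polyLaplacian_eq_zero {P : MvPolynomial (Fin d) ℝ} {k : ℕ}
    (hP : P.IsHomogeneous k) (hk : k < 2) : _root_.polyLaplacian d P = 0 := by
  rw [polyLaplacian_apply]
  refine Finset.sum_eq_zero fun i _ => ?_
  -- For `k < 2` the truncated degree `k - 1` is `0`.
  have h : (pderiv i P).IsHomogeneous 0 := by
    convert! hP.pderiv using 1
    omega
  exact h.pderiv_eq_zero i

/-- The polynomial `|x|² = ∑ i, x_i²`. -/
noncomputable def normSq (d : ℕ) : MvPolynomial (Fin d) ℝ := ∑ i, X i ^ 2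

theorem isHomogeneous_normSq : (normSq d).IsHomogeneous 2 :=
  IsHomogeneous.sum _ _ _ fun i _ => by simpa using (isHomogeneous_X ℝ i).pow 2

theorem pderiv_normSq (i : Fin d) : pderiv i (normSq d) = 2 * X i := by
  simp only [normSq, map_sum, pderiv_pow, pderiv_X, Pi.single_apply]
  simp

theorem polyLaplacian_normSq_mul {Q : MvPolynomial (Fin d) ℝ} {k : ℕ} (hQ : Q.IsHomogeneous k) :
    polyLaplacian d (normSq d * Q)
      = (2 * d + 4 * k : ℝ) • Q + normSq d * polyLaplacian d Q := by
  have h1 : polyLaplacian d (normSq d) = C (2 * d : ℝ) := by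
    simp only [polyLaplacian_apply, pderiv_normSq]
    have : ∀ i : Fin d, pderiv i (2 * X i : MvPolynomial (Fin d) ℝ) = C 2 := fun i => by
      rw [← map_ofNat C 2, pderiv_C_mul, pderiv_X_self, mul_one]
    rw [Finset.sum_congr rfl fun i _ => this i]
    simp [mul_comm]
  have h2 : ∑ i, pderiv i (normSq d) * pderiv i Q = 2 * (k • Q) := by
    rw [← hQ.sum_X_mul_pderiv, Finset.mul_sum]
    exact Finset.sum_congr rfl fun i _ => by rw [pderiv_normSq]; ring
  rw [polyLaplacian_mul, h1, h2, smul_eq_C_mul]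
  simp only [C_add, C_mul, map_ofNat, map_natCast, nsmul_eq_mul]
  ring

/-- The scalar is nonzero once `d ≥ 1`, so the Laplacian can be inverted on each piece `|x|^(2m) H`;
the harmonic decomposition depends on this. -/
theorem polyLaplacian_normSq_pow_mul {H : MvPolynomial (Fin d) ℝ} {k : ℕ}
    (hH : H.IsHomogeneous k) (hΔ : polyLaplacian d H = 0) (m : ℕ) :
    polyLaplacian d (normSq d ^ (m + 1) * H)
      = (2 * (m + 1) * (2 * m + d + 2 * k) : ℝ) • (normSq d ^ m * H) := by
  induction m with
  | zero =>
    rw [pow_one, polyLaplacian_normSq_mul hH, hΔ]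
    simp only [mul_zero, add_zero, pow_zero, one_mul]
    congr 1
    push_cast
    ring
  | succ m ih =>
    have hom : (normSq d ^ (m + 1) * H).IsHomogeneous (2 * (m + 1) + k) :=
      (isHomogeneous_normSq.pow _).mul hH
    rw [pow_succ', mul_assoc, polyLaplacian_normSq_mul hom, ih]
    rw [mul_smul_comm, ← mul_assoc, ← pow_succ', ← add_smul]
    congr 1
    push_cast
    ring

/-- The linear form `x ↦ ⟨x, y⟩`. -/
noncomputable def linForm (y : Fin d → ℝ) : MvPolynomial (Fin d) ℝ := ∑ i, C (y i) * X i

theorem isHomogeneous_linForm (y : Fin d → ℝ) : (linForm y).IsHomogeneous 1 :=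
  IsHomogeneous.sum _ _ _ fun i _ => by
    simpa using (isHomogeneous_C (Fin d) (y i)).mul (isHomogeneous_X ℝ i)

theorem pderiv_linForm (y : Fin d → ℝ) (i : Fin d) : pderiv i (linForm y) = C (y i) := by
  simp only [linForm, map_sum, pderiv_C_mul, pderiv_X, Pi.single_apply]
  simp

theorem pderiv_linForm_pow (y : Fin d → ℝ) (i : Fin d) (n : ℕ) :
    pderiv i (linForm y ^ n) = C (n * y i) * linForm y ^ (n - 1) := by
  rw [pderiv_pow, pderiv_linForm]
  simp
  ring

theorem polyLaplacian_linForm_pow {y : Fin d → ℝ} (hy : ∑ i, y i ^ 2 = 1) (n : ℕ) :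
    polyLaplacian d (linForm y ^ n) = C (n * (n - 1 : ℕ) : ℝ) * linForm y ^ (n - 2) := by
  rw [polyLaplacian_apply]
  have : ∀ i, pderiv i (pderiv i (linForm y ^ n))
      = C (y i ^ 2) * (C (n * (n - 1 : ℕ) : ℝ) * linForm y ^ (n - 2)) := fun i => by
    rw [pderiv_linForm_pow, pderiv_C_mul, pderiv_linForm_pow, Nat.sub_sub, ← mul_assoc,
      ← mul_assoc, ← C_mul, ← C_mul]
    congr 2
    ring
  simp only [this]
  rw [← Finset.sum_mul, ← map_sum, hy, C_1, one_mul]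

/-- The derivative of `P` in the direction `y`. -/
noncomputable def dirDeriv (y : Fin d → ℝ) (P : MvPolynomial (Fin d) ℝ) :
    MvPolynomial (Fin d) ℝ := ∑ i, C (y i) * pderiv i P

theorem IsHomogeneous.dirDeriv {P : MvPolynomial (Fin d) ℝ} {k : ℕ}
    (hP : P.IsHomogeneous k) (y : Fin d → ℝ) : (dirDeriv y P).IsHomogeneous (k - 1) :=
  IsHomogeneous.sum _ _ _ fun i _ => by
    simpa using (isHomogeneous_C (Fin d) (y i)).mul (hP.pderiv (i := i))

theorem polyLaplacian_dirDeriv {P : MvPolynomial (Fin d) ℝ} (hΔ : polyLaplacian d P = 0)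
    (y : Fin d → ℝ) : polyLaplacian d (dirDeriv y P) = 0 := by
  rw [dirDeriv, map_sum]
  refine Finset.sum_eq_zero fun i _ => ?_
  rw [← smul_eq_C_mul, map_smul, polyLaplacian_pderiv, hΔ, map_zero, smul_zero]

theorem IsHomogeneous.eval_dirDeriv {P : MvPolynomial (Fin d) ℝ} {k : ℕ}
    (hP : P.IsHomogeneous k) (y : Fin d → ℝ) : eval y (MvPolynomial.dirDeriv y P) = k * eval y P := by
  have := congrArg (eval y) hP.sum_X_mul_pderiv
  simpa [MvPolynomial.dirDeriv] using this

/-- The two terms match the two recursive calls of Funk–Hecke: one lowers the power by two, the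
other lowers both the power and the degree of the harmonic factor by one. -/
theorem polyLaplacian_linForm_pow_mul {y : Fin d → ℝ} (hy : ∑ i, y i ^ 2 = 1) (n : ℕ)
    {P : MvPolynomial (Fin d) ℝ} (hΔ : polyLaplacian d P = 0) :
    polyLaplacian d (linForm y ^ n * P)
      = (n * (n - 1 : ℕ) : ℝ) • (linForm y ^ (n - 2) * P)
        + (2 * n : ℝ) • (linForm y ^ (n - 1) * dirDeriv y P) := by
  rw [polyLaplacian_mul, hΔ, polyLaplacian_linForm_pow hy, smul_eq_C_mul, smul_eq_C_mul, dirDeriv,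
    mul_zero, add_zero, mul_assoc, Finset.mul_sum, Finset.mul_sum, Finset.mul_sum]
  congr 1
  refine Finset.sum_congr rfl fun i _ => ?_
  rw [pderiv_linForm_pow]
  simp only [C_mul, map_ofNat, map_natCast]
  ring

/-- Every homogeneous polynomial is a combination of powers of `|x|²` times harmonic homogeneous
polynomials. -/
theorem IsHomogeneous.mem_span_normSq_pow_mul (hd : 1 ≤ d) (n : ℕ)
    {P : MvPolynomial (Fin d) ℝ} (hP : P.IsHomogeneous n) :
    P ∈ Submodule.span ℝ {R : MvPolynomial (Fin d) ℝ | ∃ (m k : ℕ) (H : MvPolynomial (Fin d) ℝ),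
      k + 2 * m = n ∧ H.IsHomogeneous k ∧ _root_.polyLaplacian d H = 0 ∧ R = normSq d ^ m * H} := by
  induction n using Nat.strong_induction_on generalizing P with
  | _ n ih =>
  obtain hn | hn := lt_or_ge n 2
  · exact Submodule.subset_span ⟨0, n, P, by simp, hP, hP.polyLaplacian_eq_zero hn, by simp⟩
  -- The Laplacian is surjective from the degree `n` span onto the degree `n - 2` span. A preimage
  -- `Q` of `ΔP` then makes `P - Q` harmonic.
  · have lift : ∀ R ∈ Submodule.span ℝ {R : MvPolynomial (Fin d) ℝ |
        ∃ (m k : ℕ) (H : MvPolynomial (Fin d) ℝ), k + 2 * m = n - 2 ∧ H.IsHomogeneous k ∧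
          _root_.polyLaplacian d H = 0 ∧ R = normSq d ^ m * H},
        ∃ Q ∈ Submodule.span ℝ {R : MvPolynomial (Fin d) ℝ |
          ∃ (m k : ℕ) (H : MvPolynomial (Fin d) ℝ), k + 2 * m = n ∧ H.IsHomogeneous k ∧
          _root_.polyLaplacian d H = 0 ∧ R = normSq d ^ m * H},
          Q.IsHomogeneous n ∧ _root_.polyLaplacian d Q = R := by
      intro R hR
      induction hR using Submodule.span_induction with
      | mem R hR =>
        obtain ⟨m, k, H, hmk, hH, hΔ, rfl⟩ := hR
        have hc : (2 * (m + 1) * (2 * m + d + 2 * k) : ℝ) ≠ 0 := by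
          have : (1 : ℝ) ≤ d := by exact_mod_cast hd
          positivity
        have hom : (normSq d ^ (m + 1) * H).IsHomogeneous n := by
          convert! (isHomogeneous_normSq.pow (m + 1)).mul hH using 1
          omega
        refine ⟨(2 * (m + 1) * (2 * m + d + 2 * k) : ℝ)⁻¹ • (normSq d ^ (m + 1) * H),
          Submodule.smul_mem _ _ (Submodule.subset_span
            ⟨m + 1, k, H, by omega, hH, hΔ, rfl⟩),
          (homogeneousSubmodule (Fin d) ℝ n).smul_mem _ hom, ?_⟩
        rw [map_smul, polyLaplacian_normSq_pow_mul hH hΔ, smul_smul, inv_mul_cancel₀ hc, one_smul]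
      | zero => exact ⟨0, Submodule.zero_mem _, isHomogeneous_zero _ _ _, map_zero _⟩
      | add R S _ _ hR hS =>
        obtain ⟨Q, hQ, hQh, rfl⟩ := hR
        obtain ⟨T, hT, hTh, rfl⟩ := hS
        exact ⟨Q + T, Submodule.add_mem _ hQ hT, hQh.add hTh, map_add _ _ _⟩
      | smul a R _ hR =>
        obtain ⟨Q, hQ, hQh, rfl⟩ := hR
        exact ⟨a • Q, Submodule.smul_mem _ _ hQ,
          (homogeneousSubmodule (Fin d) ℝ n).smul_mem _ hQh, map_smul _ _ _⟩
    obtain ⟨Q, hQ, hQh, hQΔ⟩ := lift _ (ih (n - 2) (by omega) hP.polyLaplacian)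
    rw [← sub_add_cancel P Q]
    refine Submodule.add_mem _ (Submodule.subset_span ⟨0, n, P - Q, by simp, hP.sub hQh, ?_, by simp⟩) hQ
    rw [map_sub, hQΔ, sub_self]

end MvPolynomial

/-! ### Gaussian integrals, polar coordinates and Green's identity. -/

section GaussianIntegrals

theorem integrable_pow_mul_exp_neg_sq (n : ℕ) :
    Integrable fun x : ℝ => x ^ n * Real.exp (-x ^ 2) := by
  have := integrable_rpow_mul_exp_neg_mul_sq (b := 1) one_pos (s := n)
    (by have : (0 : ℝ) ≤ n := by positivity
        linarith)
  simpa using this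

theorem integral_pow_add_two_mul_exp_neg_sq (n : ℕ) :
    2 * ∫ x : ℝ, x ^ (n + 2) * Real.exp (-x ^ 2)
      = (n + 1) * ∫ x : ℝ, x ^ n * Real.exp (-x ^ 2) := by
  have hu : ∀ x : ℝ, HasDerivAt (fun x : ℝ => x ^ (n + 1)) ((n + 1) * x ^ n) x := fun x => by
    simpa using hasDerivAt_pow (n + 1) x
  have hv : ∀ x : ℝ, HasDerivAt (fun x : ℝ => Real.exp (-x ^ 2)) (Real.exp (-x ^ 2) * -(2 * x)) x :=
    fun x => by simpa using ((hasDerivAt_pow 2 x).neg).exp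
  have h := integral_mul_deriv_eq_deriv_mul_of_integrable (fun x _ => hu x) (fun x _ => hv x)
    (((integrable_pow_mul_exp_neg_sq (n + 2)).const_mul (-2)).congr
      (.of_forall fun x => by simp only [Pi.mul_apply]; ring))
    (((integrable_pow_mul_exp_neg_sq n).const_mul (n + 1)).congr
      (.of_forall fun x => by simp only [Pi.mul_apply]; ring))
    (integrable_pow_mul_exp_neg_sq (n + 1))
  rw [← integral_const_mul, ← integral_const_mul]
  rw [← neg_inj]
  convert! h using 1
  · rw [← integral_neg]
    exact integral_congr_ae (.of_forall fun x => by ring)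
  · rw [neg_inj]
    exact integral_congr_ae (.of_forall fun x => by ring)

theorem integral_Ioi_pow_mul_exp_neg_sq (n : ℕ) :
    ∫ r in Set.Ioi (0 : ℝ), r ^ n * Real.exp (-r ^ 2) = 1 / 2 * Real.Gamma ((n + 1) / 2) := by
  have := integral_rpow_mul_exp_neg_rpow (p := 2) (q := n) two_pos
    (by have : (0 : ℝ) ≤ n := by positivity
        linarith)
  simpa using this

theorem integral_Ioi_pow_mul_exp_neg_sq_pos (n : ℕ) :
    0 < ∫ r in Set.Ioi (0 : ℝ), r ^ n * Real.exp (-r ^ 2) := by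
  rw [integral_Ioi_pow_mul_exp_neg_sq]
  have := Real.Gamma_pos_of_pos (s := ((n : ℝ) + 1) / 2) (by positivity)
  positivity

theorem integral_Ioi_pow_add_two_mul_exp_neg_sq (n : ℕ) :
    2 * ∫ r in Set.Ioi (0 : ℝ), r ^ (n + 2) * Real.exp (-r ^ 2)
      = (n + 1) * ∫ r in Set.Ioi (0 : ℝ), r ^ n * Real.exp (-r ^ 2) := by
  rw [integral_Ioi_pow_mul_exp_neg_sq, integral_Ioi_pow_mul_exp_neg_sq]
  have : ((n + 2 : ℕ) + 1 : ℝ) / 2 = ((n : ℝ) + 1) / 2 + 1 := by push_cast; ring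
  rw [this, Real.Gamma_add_one (by positivity)]
  ring

open MvPolynomial

variable {d : ℕ}

theorem exp_neg_norm_sq (x : EuclideanSpace ℝ (Fin d)) :
    Real.exp (-‖x‖ ^ 2) = ∏ i, Real.exp (-x i ^ 2) := by
  rw [EuclideanSpace.real_norm_sq_eq, ← Finset.sum_neg_distrib, Real.exp_sum]

theorem eval_monomial_mul_exp (s : Fin d →₀ ℕ) (x : EuclideanSpace ℝ (Fin d)) :
    eval (fun i => x i) (monomial s (1 : ℝ)) * Real.exp (-‖x‖ ^ 2)
      = ∏ i, x i ^ s i * Real.exp (-x i ^ 2) := by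
  rw [exp_neg_norm_sq, Finset.prod_mul_distrib, eval_monomial, one_mul,
    Finsupp.prod_fintype _ _ fun i => pow_zero _]

theorem integrable_monomial_mul_exp (s : Fin d →₀ ℕ) :
    Integrable fun x : EuclideanSpace ℝ (Fin d) =>
      eval (fun i => x i) (monomial s (1 : ℝ)) * Real.exp (-‖x‖ ^ 2) := by
  simp only [eval_monomial_mul_exp]
  rw [← (PiLp.volume_preserving_toLp (Fin d)).integrable_comp_emb
    (MeasurableEquiv.toLp 2 _).measurableEmbedding]
  exact Integrable.fintype_prod fun i => integrable_pow_mul_exp_neg_sq (s i)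

theorem integral_monomial_mul_exp (s : Fin d →₀ ℕ) :
    ∫ x : EuclideanSpace ℝ (Fin d),
      eval (fun i => x i) (monomial s (1 : ℝ)) * Real.exp (-‖x‖ ^ 2)
      = ∏ i, ∫ t : ℝ, t ^ s i * Real.exp (-t ^ 2) := by
  simp only [eval_monomial_mul_exp]
  rw [← (PiLp.volume_preserving_toLp (Fin d)).integral_comp
    (MeasurableEquiv.toLp 2 _).measurableEmbedding]
  exact integral_fintype_prod_volume_eq_prod fun i (t : ℝ) => t ^ s i * Real.exp (-t ^ 2)

theorem integrable_eval_mul_exp (P : MvPolynomial (Fin d) ℝ) :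
    Integrable fun x : EuclideanSpace ℝ (Fin d) =>
      eval (fun i => x i) P * Real.exp (-‖x‖ ^ 2) := by
  induction P using MvPolynomial.induction_on' with
  | monomial s a =>
    refine ((integrable_monomial_mul_exp s).const_mul a).congr (.of_forall fun x => ?_)
    simp only [eval_monomial]
    ring
  | add P Q hP hQ =>
    refine (hP.add hQ).congr (.of_forall fun x => ?_)
    simp only [Pi.add_apply, map_add]
    ring

/-- The integral of a polynomial against the weight `exp (-|x|²)`. -/
noncomputable def gaussInt (d : ℕ) : MvPolynomial (Fin d) ℝ →ₗ[ℝ] ℝ where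
  toFun P := ∫ x : EuclideanSpace ℝ (Fin d), eval (fun i => x i) P * Real.exp (-‖x‖ ^ 2)
  map_add' P Q := by
    rw [← integral_add (integrable_eval_mul_exp P) (integrable_eval_mul_exp Q)]
    simp only [map_add, add_mul]
  map_smul' a P := by
    simp only [smul_eval, RingHom.id_apply, smul_eq_mul, mul_assoc, integral_const_mul]

/-- Integration by parts in the variable `x_i`, as `2 x_i exp (-|x|²)` is minus the derivative of
the weight. On monomials only the `i`-th one-dimensional factor is affected. -/
theorem gaussInt_X_mul_pderiv (i : Fin d) (P : MvPolynomial (Fin d) ℝ) :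
    2 * gaussInt d (X i * pderiv i P) = gaussInt d (pderiv i (pderiv i P)) := by
  induction P using MvPolynomial.induction_on' with
  | add P Q hP hQ => simp only [map_add, mul_add, hP, hQ]
  | monomial s a =>
    have key : ∀ t : Fin d →₀ ℕ, gaussInt d (monomial t 1)
        = (∫ u : ℝ, u ^ t i * Real.exp (-u ^ 2)) *
          ∏ j ∈ univ.erase i, ∫ u : ℝ, u ^ t j * Real.exp (-u ^ 2) := fun t => by
      rw [Finset.mul_prod_erase univ (fun j => ∫ u : ℝ, u ^ t j * Real.exp (-u ^ 2))
        (Finset.mem_univ i)]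
      exact integral_monomial_mul_exp t
    rw [X_mul_pderiv_monomial, pderiv_monomial, pderiv_monomial, map_nsmul]
    have ha : ∀ (t : Fin d →₀ ℕ) (b : ℝ), monomial t b = b • monomial t (1 : ℝ) := fun t b => by
      rw [smul_monomial, smul_eq_mul, mul_one]
    rw [ha s, ha _ (_ * _), map_smul, map_smul, key, key]
    have hprod : ∏ j ∈ univ.erase i, ∫ u : ℝ,
        u ^ (s - Finsupp.single i 1 - Finsupp.single i 1 : Fin d →₀ ℕ) j * Real.exp (-u ^ 2)
        = ∏ j ∈ univ.erase i, ∫ u : ℝ, u ^ s j * Real.exp (-u ^ 2) := by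
      refine Finset.prod_congr rfl fun j hj => ?_
      simp [(Finset.ne_of_mem_erase hj).symm]
    rw [hprod]
    simp only [Finsupp.coe_tsub, Pi.sub_apply, Finsupp.single_eq_same, smul_eq_mul, nsmul_eq_mul]
    -- Exponents `0` and `1` are separate because `s i - 1 - 1` truncates: both sides vanish there,
    -- for exponent `1` on the left since the integrand is odd.
    obtain h | h | ⟨n, h⟩ : s i = 0 ∨ s i = 1 ∨ ∃ n, s i = n + 2 := by
      rcases hs : s i with _ | _ | n
      · simp
      · simp
      · exact Or.inr (Or.inr ⟨n, rfl⟩)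
    · simp [h]
    · simp only [h]
      have h1 : ∫ u : ℝ, u ^ 1 * Real.exp (-u ^ 2) = 0 := by
        have := integral_neg_eq_self (fun u : ℝ => u ^ 1 * Real.exp (-u ^ 2)) volume
        simp only [pow_one, neg_mul, neg_sq, integral_neg] at this ⊢
        linarith
      simp only [pow_one] at h1
      simp [h1]
    · rw [h]
      have := integral_pow_add_two_mul_exp_neg_sq n
      rw [show n + 2 - 1 - 1 = n by omega, show n + 2 - 1 = n + 1 by omega]
      push_cast
      linear_combination a * (n + 2) * (∏ j ∈ univ.erase i, ∫ u : ℝ, u ^ s j * Real.exp (-u ^ 2)) * this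

/-- Summing the integration by parts over `i` produces the Euler operator, which acts on `P` as `k`.
-/
theorem gaussInt_polyLaplacian {P : MvPolynomial (Fin d) ℝ} {k : ℕ} (hP : P.IsHomogeneous k) :
    gaussInt d (polyLaplacian d P) = 2 * k * gaussInt d P := by
  have h := congrArg (gaussInt d) hP.sum_X_mul_pderiv
  simp only [polyLaplacian, LinearMap.sum_apply, LinearMap.comp_apply, map_sum] at h ⊢
  rw [map_nsmul, nsmul_eq_mul] at h
  rw [mul_assoc, ← h, Finset.mul_sum]
  exact Finset.sum_congr rfl fun i _ => (gaussInt_X_mul_pderiv i P).symm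

theorem eval_mul_left_of_isHomogeneous {P : MvPolynomial (Fin d) ℝ} {k : ℕ}
    (hP : P.IsHomogeneous k) (r : ℝ) (x : Fin d → ℝ) :
    eval (fun i => r * x i) P = r ^ k * eval x P := by
  rw [eval_eq', eval_eq', Finset.mul_sum]
  refine Finset.sum_congr rfl fun s hs => ?_
  have hk : ∑ i, s i = k := by
    rw [← Finsupp.degree_eq_sum, Finsupp.degree_eq_weight_one]
    exact hP (mem_support_iff.1 hs)
  simp only [mul_pow, Finset.prod_mul_distrib, Finset.prod_pow_eq_pow_sum, hk]
  ring

theorem integral_volumeIoiPow (n : ℕ) (f : ℝ → ℝ) :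
    ∫ r : Set.Ioi (0 : ℝ), f r ∂(Measure.volumeIoiPow n) = ∫ r in Set.Ioi (0 : ℝ), r ^ n * f r := by
  simp only [Measure.volumeIoiPow, ENNReal.ofReal]
  rw [integral_withDensity_eq_integral_smul,
    integral_subtype_comap measurableSet_Ioi fun a ↦ Real.toNNReal (a ^ n) • f a,
    setIntegral_congr_fun measurableSet_Ioi fun x hx ↦ ?_]
  · rw [NNReal.smul_def, Real.coe_toNNReal _ (pow_nonneg hx.out.le _), smul_eq_mul]
  · exact (measurable_subtype_coe.pow_const _).real_toNNReal

theorem restrictToSphere_apply (P : MvPolynomial (Fin d) ℝ) (x : UnitSphere d) :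
    restrictToSphere d P x = eval (fun i => x.1 i) P := by
  rw [← aeval_eq_eval]
  rfl

/-- Polar coordinates: homogeneity separates the integrand into an angular and a radial factor. -/
theorem gaussInt_eq_integral_toSphere_mul {P : MvPolynomial (Fin d) ℝ} {k : ℕ}
    (hP : P.IsHomogeneous k) (hd : 1 ≤ d) :
    gaussInt d P
      = (∫ u, restrictToSphere d P u ∂(volume : Measure (EuclideanSpace ℝ (Fin d))).toSphere)
        * ∫ r in Set.Ioi (0 : ℝ), r ^ (k + (d - 1)) * Real.exp (-r ^ 2) := by
  have : Nontrivial (EuclideanSpace ℝ (Fin d)) := by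
    have : Nonempty (Fin d) := ⟨⟨0, hd⟩⟩
    infer_instance
  calc gaussInt d P
      = ∫ x : ({0}ᶜ : Set (EuclideanSpace ℝ (Fin d))),
          eval (fun i => x.1 i) P * Real.exp (-‖x.1‖ ^ 2) ∂(volume.comap Subtype.val) := by
        rw [integral_subtype_comap (measurableSet_singleton _).compl
          fun x : EuclideanSpace ℝ (Fin d) => eval (fun i => x i) P * Real.exp (-‖x‖ ^ 2),
          restrict_compl_singleton]
        rfl
    _ = ∫ p : UnitSphere d × Set.Ioi (0 : ℝ),
          restrictToSphere d P p.1 * (p.2.1 ^ k * Real.exp (-p.2.1 ^ 2))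
          ∂(volume : Measure (EuclideanSpace ℝ (Fin d))).toSphere.prod
            (.volumeIoiPow (Module.finrank ℝ (EuclideanSpace ℝ (Fin d)) - 1)) := by
        rw [← (Measure.measurePreserving_homeomorphUnitSphereProd
          (volume : Measure (EuclideanSpace ℝ (Fin d)))).integral_comp
          (Homeomorph.measurableEmbedding _)]
        refine integral_congr_ae (.of_forall fun x => ?_)
        have hx : ‖x.1‖ ≠ 0 := norm_ne_zero_iff.2 x.2
        simp only [homeomorphUnitSphereProd_apply_snd_coe, restrictToSphere_apply,
          homeomorphUnitSphereProd_apply_fst_coe]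
        rw [← mul_assoc, mul_comm (eval _ P) (_ ^ k), ← eval_mul_left_of_isHomogeneous hP]
        congr 3
        ext i
        simp [hx]
    _ = _ := by
        rw [integral_prod_mul (restrictToSphere d P)
          fun r : Set.Ioi (0 : ℝ) => r.1 ^ k * Real.exp (-r.1 ^ 2), finrank_euclideanSpace_fin,
          integral_volumeIoiPow _ fun r => r ^ k * Real.exp (-r ^ 2)]
        congr 1
        refine integral_congr_ae (.of_forall fun r => ?_)
        simp only
        ring

theorem continuous_restrictToSphere (P : MvPolynomial (Fin d) ℝ) :
    Continuous (restrictToSphere d P) := by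
  have : restrictToSphere d P = fun x : UnitSphere d => eval (fun i => x.1 i) P :=
    funext (restrictToSphere_apply P)
  rw [this]
  exact P.continuous_eval.comp (by fun_prop)

theorem integrable_restrictToSphere (P : MvPolynomial (Fin d) ℝ) :
    Integrable (restrictToSphere d P)
      (volume : Measure (EuclideanSpace ℝ (Fin d))).toSphere :=
  (continuous_restrictToSphere P).integrable_of_hasCompactSupport
    (HasCompactSupport.of_compactSpace _)

/-- The integral of a polynomial over the sphere, against the uniform probability measure. -/
noncomputable def sphereInt (d : ℕ) : MvPolynomial (Fin d) ℝ →ₗ[ℝ] ℝ where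
  toFun P := ∫ x, restrictToSphere d P x ∂(uniformSphere d)
  map_add' P Q := by
    simp only [uniformSphere, integral_smul_measure, map_add, Pi.add_apply]
    rw [integral_add (integrable_restrictToSphere P) (integrable_restrictToSphere Q), smul_add]
  map_smul' a P := by
    simp only [map_smul, Pi.smul_apply, RingHom.id_apply, smul_eq_mul, integral_const_mul]

theorem sphereInt_apply (P : MvPolynomial (Fin d) ℝ) :
    sphereInt d P = ∫ x, restrictToSphere d P x ∂(uniformSphere d) := rfl

theorem sphereInt_one (hd : 1 ≤ d) : sphereInt d 1 = 1 := by
  have : Nontrivial (EuclideanSpace ℝ (Fin d)) := by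
    have : Nonempty (Fin d) := ⟨⟨0, hd⟩⟩
    infer_instance
  have h0 : (volume : Measure (EuclideanSpace ℝ (Fin d))).toSphere Set.univ ≠ 0 := by
    rw [Ne, Measure.measure_univ_eq_zero]
    exact Measure.toSphere_ne_zero _
  simp only [sphereInt_apply, restrictToSphere_apply, map_one, uniformSphere,
    integral_const, smul_eq_mul, mul_one, measureReal_ennreal_smul_apply, ENNReal.toReal_inv]
  exact inv_mul_cancel₀ (ENNReal.toReal_ne_zero.2 ⟨h0, measure_ne_top _ _⟩)

/-- Green's identity on the sphere, for homogeneous polynomials. -/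
theorem mul_sphereInt_eq_sphereInt_polyLaplacian (hd : 1 ≤ d) (k : ℕ) (P : MvPolynomial (Fin d) ℝ)
    (hP : P.IsHomogeneous k) :
    (k * (k + d - 2) : ℝ) * sphereInt d P = sphereInt d (polyLaplacian d P) := by
  simp only [sphereInt_apply, uniformSphere, integral_smul_measure, smul_eq_mul]
  rw [mul_left_comm]
  congr 1
  have h := gaussInt_polyLaplacian hP
  rw [gaussInt_eq_integral_toSphere_mul hP hd, gaussInt_eq_integral_toSphere_mul hP.polyLaplacian hd] at h
  obtain hk | hk := lt_or_ge k 2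
  · rw [hP.polyLaplacian_eq_zero hk] at h ⊢
    have h1 := (integral_Ioi_pow_mul_exp_neg_sq_pos (k + (d - 1))).ne'
    simp only [map_zero, Pi.zero_apply, integral_zero, zero_mul] at h ⊢
    have := (mul_eq_zero.1 ((mul_assoc _ _ _).trans h.symm)).resolve_right h1
    linear_combination (k + d - 2 : ℝ) / 2 * this
  · obtain ⟨k, rfl⟩ := Nat.exists_eq_add_of_le' hk
    rw [show k + 2 - 2 = k by omega, show k + 2 + (d - 1) = k + (d - 1) + 2 by omega] at h
    have h1 := (integral_Ioi_pow_mul_exp_neg_sq_pos (k + (d - 1))).ne'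
    -- The radial integrals for `P` and `ΔP` differ by the factor `(k + d) / 2`, where `k` is now
    -- the degree of `ΔP`; this turns the Gaussian constant into the spherical eigenvalue.
    have h2 := integral_Ioi_pow_add_two_mul_exp_neg_sq (k + (d - 1))
    have h3 : ((d - 1 : ℕ) : ℝ) = d - 1 := by push_cast [hd]; ring
    refine mul_right_cancel₀ h1 ?_
    push_cast at h h2 ⊢
    rw [h3] at h2
    rw [h]
    linear_combination -(k + 2 : ℝ) * (∫ u, restrictToSphere d P u
      ∂(volume : Measure (EuclideanSpace ℝ (Fin d))).toSphere) * h2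

end GaussianIntegrals

/-! ### Funk–Hecke coefficients and formula, for any functional satisfying Green's identity. -/

section FunkHecke

open MvPolynomial

/-- The coefficient of the reproducing kernel of degree `l` in `⟨x, y⟩ ^ (l + 2 * m)`. -/
noncomputable def zonalCoeff (d l m : ℕ) : ℝ :=
  ((d : ℝ) - 2) / 2 * (Nat.factorial (l + 2 * m) : ℝ) /
    (2 ^ (l + 2 * m) * (Nat.factorial m : ℝ) *
      (ascPochhammer ℝ (l + m + 1)).eval (((d : ℝ) - 2) / 2))

section Coefficients

variable {d : ℕ}

theorem half_sub_two_pos (hd : 3 ≤ d) : 0 < ((d : ℝ) - 2) / 2 := by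
  have : (3 : ℝ) ≤ d := by exact_mod_cast hd
  linarith

theorem zonalCoeff_pos (hd : 3 ≤ d) (l m : ℕ) : 0 < zonalCoeff d l m := by
  have h0 := half_sub_two_pos hd
  have := ascPochhammer_pos (l + m + 1) _ h0
  unfold zonalCoeff
  positivity

theorem zonalCoeff_zero_zero (hd : 3 ≤ d) : zonalCoeff d 0 0 = 1 := by
  have h0 := (half_sub_two_pos hd).ne'
  simp [zonalCoeff, -div_eq_zero_iff, h0]

theorem zonalCoeff_succ_right (hd : 3 ≤ d) (l m : ℕ) :
    ((l + 2 * m + 2) * (l + 2 * m + 1) : ℝ) * zonalCoeff d l m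
      = 4 * (m + 1) * (((d : ℝ) - 2) / 2 + l + m + 1) * zonalCoeff d l (m + 1) := by
  have h0 := half_sub_two_pos hd
  have h1 := ascPochhammer_pos (l + m + 1) _ h0
  unfold zonalCoeff
  rw [show l + 2 * (m + 1) = l + 2 * m + 1 + 1 by ring, show l + (m + 1) + 1 = l + m + 1 + 1 by ring,
    Nat.factorial_succ (l + 2 * m + 1), Nat.factorial_succ (l + 2 * m), Nat.factorial_succ m,
    ascPochhammer_succ_eval (l + m + 1)]
  generalize (ascPochhammer ℝ (l + m + 1)).eval (((d : ℝ) - 2) / 2) = A at *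
  generalize ((d : ℝ) - 2) / 2 = r at *
  have h2 : (0 : ℝ) < r + l + m + 1 := by positivity
  push_cast
  have h3 : (r + (l + m + 1 : ℝ)) ≠ 0 := by rw [← add_assoc, ← add_assoc]; exact h2.ne'
  have : (Nat.factorial m : ℝ) ≠ 0 := by positivity
  field_simp
  ring

theorem zonalCoeff_succ_left (hd : 3 ≤ d) (l m : ℕ) :
    (l + 2 * m + 1 : ℝ) * zonalCoeff d l m
      = 2 * (((d : ℝ) - 2) / 2 + l + m + 1) * zonalCoeff d (l + 1) m := by
  have h0 := half_sub_two_pos hd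
  have h1 := ascPochhammer_pos (l + m + 1) _ h0
  unfold zonalCoeff
  rw [show l + 1 + 2 * m = l + 2 * m + 1 by ring, show l + 1 + m + 1 = l + m + 1 + 1 by ring,
    Nat.factorial_succ (l + 2 * m), ascPochhammer_succ_eval (l + m + 1)]
  generalize (ascPochhammer ℝ (l + m + 1)).eval (((d : ℝ) - 2) / 2) = A at *
  generalize ((d : ℝ) - 2) / 2 = r at *
  have h2 : (0 : ℝ) < r + l + m + 1 := by positivity
  push_cast
  have h3 : (r + (l + m + 1 : ℝ)) ≠ 0 := by rw [← add_assoc, ← add_assoc]; exact h2.ne'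
  have : (Nat.factorial m : ℝ) ≠ 0 := by positivity
  field_simp
  ring

/-- With `r = (d - 2) / 2 > 0`, the first factor is `r` and each later factor `r + j` is at least
`j`. -/
theorem factorial_mul_le_ascPochhammer (hd : 3 ≤ d) (k : ℕ) :
    ((d : ℝ) - 2) / 2 * (Nat.factorial k : ℝ)
      ≤ (ascPochhammer ℝ (k + 1)).eval (((d : ℝ) - 2) / 2) := by
  have h0 := half_sub_two_pos hd
  induction k with
  | zero => simp
  | succ k ih =>
    rw [ascPochhammer_succ_eval, Nat.factorial_succ]
    push_cast
    rw [mul_left_comm, mul_comm]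
    exact mul_le_mul ih (by linarith) (by positivity) (ascPochhammer_pos _ _ h0).le

/-- Write `(l + 2m)!` as `choose (l + 2m) m * m! * (l + m)!` and bound the binomial by `2 ^ (l +
2m)`. -/
theorem zonalCoeff_le_one (hd : 3 ≤ d) (l m : ℕ) : zonalCoeff d l m ≤ 1 := by
  have h0 := half_sub_two_pos hd
  have h1 := ascPochhammer_pos (l + m + 1) _ h0
  unfold zonalCoeff
  rw [div_le_one (by positivity)]
  have h2 : (Nat.factorial (l + 2 * m) : ℝ)
      ≤ 2 ^ (l + 2 * m) * Nat.factorial m * Nat.factorial (l + m) := by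
    have h3 := Nat.choose_mul_factorial_mul_factorial (n := l + 2 * m) (k := m) (by omega)
    rw [show l + 2 * m - m = l + m by omega] at h3
    rw [← h3]
    push_cast
    gcongr
    exact_mod_cast Nat.choose_le_two_pow _ _
  calc ((d : ℝ) - 2) / 2 * (Nat.factorial (l + 2 * m) : ℝ)
      ≤ ((d : ℝ) - 2) / 2 * (2 ^ (l + 2 * m) * Nat.factorial m * Nat.factorial (l + m)) := by gcongr
    _ = 2 ^ (l + 2 * m) * Nat.factorial m * (((d : ℝ) - 2) / 2 * Nat.factorial (l + m)) := by ring
    _ ≤ _ := by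
      gcongr
      exact factorial_mul_le_ascPochhammer hd _

end Coefficients

section Functional

variable {d : ℕ} {J : MvPolynomial (Fin d) ℝ →ₗ[ℝ] ℝ}

/-- A harmonic homogeneous polynomial is orthogonal to all homogeneous polynomials of lower
degree. -/
theorem map_mul_eq_zero_of_harmonic (hd : 3 ≤ d)
    (hJ : ∀ (k : ℕ) (P : MvPolynomial (Fin d) ℝ), P.IsHomogeneous k →
      (k * (k + d - 2) : ℝ) * J P = J (polyLaplacian d P))
    {n k : ℕ} {Q P : MvPolynomial (Fin d) ℝ} (hQ : Q.IsHomogeneous n) (hP : P.IsHomogeneous k)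
    (hΔ : polyLaplacian d P = 0) (hnk : n < k) : J (Q * P) = 0 := by
  induction n using Nat.strong_induction_on generalizing k Q P with
  | _ n ih =>
  have h := hJ _ _ (hQ.mul hP)
  rw [polyLaplacian_mul, hΔ, mul_zero, add_zero, map_add] at h
  have h1 : J (polyLaplacian d Q * P) = 0 := by
    obtain hn | hn := lt_or_ge n 2
    · rw [hQ.polyLaplacian_eq_zero hn, zero_mul, map_zero]
    · exact ih (n - 2) (by omega) hQ.polyLaplacian hP hΔ (by omega)
  have h2 : J (2 * ∑ i, pderiv i Q * pderiv i P) = 0 := by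
    rw [← map_ofNat C 2, ← smul_eq_C_mul, map_smul, map_sum, Finset.sum_eq_zero, smul_zero]
    intro i _
    obtain rfl | hn := Nat.eq_zero_or_pos n
    · rw [hQ.pderiv_eq_zero, zero_mul, map_zero]
    · exact ih (n - 1) (by omega) hQ.pderiv hP.pderiv
        (by rw [polyLaplacian_pderiv, hΔ, map_zero]) (by omega)
  rw [h1, h2, add_zero] at h
  refine (mul_eq_zero.1 h).resolve_left ?_
  -- The eigenvalue `(n + k) (n + k + d - 2)` is positive because `k > n ≥ 0`.
  have h3 : (1 : ℝ) ≤ k := by exact_mod_cast (by omega : 1 ≤ k)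
  have h4 : (3 : ℝ) ≤ d := by exact_mod_cast hd
  have h5 : (0 : ℝ) ≤ n := by positivity
  push_cast
  exact (mul_pos (by linarith) (by linarith)).ne'

/-- The Funk–Hecke formula for powers of a linear form. -/
theorem map_linForm_pow_mul (hd : 3 ≤ d)
    (hJ : ∀ (k : ℕ) (P : MvPolynomial (Fin d) ℝ), P.IsHomogeneous k →
      (k * (k + d - 2) : ℝ) * J P = J (polyLaplacian d P))
    (hJ1 : J 1 = 1) {y : Fin d → ℝ} (hy : ∑ i, y i ^ 2 = 1) {n l m : ℕ} (hn : l + 2 * m = n)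
    {P : MvPolynomial (Fin d) ℝ} (hP : P.IsHomogeneous l) (hΔ : polyLaplacian d P = 0) :
    J (linForm y ^ n * P) = zonalCoeff d l m * eval y P := by
  induction n using Nat.strong_induction_on generalizing l m P with
  | _ n ih =>
  obtain rfl | hn0 := Nat.eq_zero_or_pos n
  · obtain ⟨rfl, rfl⟩ : l = 0 ∧ m = 0 := by omega
    rw [← totalDegree_zero_iff_isHomogeneous, totalDegree_eq_zero_iff_eq_C] at hP
    rw [hP, pow_zero, one_mul, zonalCoeff_zero_zero hd, eval_C, one_mul, ← mul_one (C _),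
      ← smul_eq_C_mul, map_smul, hJ1, smul_eq_mul, mul_one]
  have hom : (linForm y ^ n * P).IsHomogeneous (n + l) := by
    simpa using ((isHomogeneous_linForm y).pow n).mul hP
  have h := hJ _ _ hom
  rw [polyLaplacian_linForm_pow_mul hy n hΔ, map_add, map_smul, map_smul] at h
  -- With `r = (d - 2) / 2`, the eigenvalue in degree `n + l = 2 (l + m)` is `4 (l + m) (r + l +
  -- m)`. The two terms of the Laplacian supply its `m` part and its `l` part.
  have h1 : (n * (n - 1 : ℕ) : ℝ) * J (linForm y ^ (n - 2) * P)
      = 4 * m * (((d : ℝ) - 2) / 2 + l + m) * (zonalCoeff d l m * eval y P) := by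
    -- For `m = 0` the power has degree `n - 2 < l`, so orthogonality kills the term.
    cases m with
    | zero =>
      have h3 : (linForm y ^ (n - 2)).IsHomogeneous (n - 2) := by
        simpa using (isHomogeneous_linForm y).pow (n - 2)
      rw [map_mul_eq_zero_of_harmonic hd hJ h3 hP hΔ (by omega)]
      simp
    | succ m =>
      rw [ih (n - 2) (by omega) (show l + 2 * m = n - 2 by omega) hP hΔ]
      subst hn
      rw [show l + 2 * (m + 1) - 1 = l + 2 * m + 1 by omega]
      have := zonalCoeff_succ_right hd l m
      push_cast
      linear_combination eval y P * this
  have h2 : (2 * n : ℝ) * J (linForm y ^ (n - 1) * dirDeriv y P)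
      = 4 * l * (((d : ℝ) - 2) / 2 + l + m) * (zonalCoeff d l m * eval y P) := by
    -- For `l = 0` the polynomial is constant. Otherwise its directional derivative is harmonic of
    -- degree one less, and Euler's identity at `y` recovers `P y`.
    cases l with
    | zero =>
      have : dirDeriv y P = 0 := by simp [dirDeriv, hP.pderiv_eq_zero]
      simp [this]
    | succ l =>
      rw [ih (n - 1) (by omega) (show l + 2 * m = n - 1 by omega) (hP.dirDeriv y)
        (polyLaplacian_dirDeriv hΔ y), hP.eval_dirDeriv]
      subst hn
      have := zonalCoeff_succ_left hd l m
      push_cast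
      linear_combination 2 * (l + 1 : ℝ) * eval y P * this
  rw [smul_eq_mul, smul_eq_mul, h1, h2] at h
  have hpos : (0 : ℝ) < (l + m) * (((d : ℝ) - 2) / 2 + l + m) := by
    have h0 := half_sub_two_pos hd
    have : (1 : ℝ) ≤ l + m := by exact_mod_cast (by omega : 1 ≤ l + m)
    positivity
  refine mul_left_cancel₀ hpos.ne' ?_
  subst hn
  push_cast at h
  linear_combination h / 4

end Functional

end FunkHecke

/-! ### Expansions on the sphere in an orthonormal basis. -/

section SphereExpansion

open MvPolynomial

variable {d : ℕ}

theorem restrictToSphere_mul (P Q : MvPolynomial (Fin d) ℝ) :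
    restrictToSphere d (P * Q) = restrictToSphere d P * restrictToSphere d Q := by
  ext x
  simp [restrictToSphere_apply]

theorem sum_sq_coord (x : UnitSphere d) : ∑ i, x.1 i ^ 2 = 1 := by
  rw [← EuclideanSpace.real_norm_sq_eq, norm_eq_of_mem_sphere x, one_pow]

theorem restrictToSphere_normSq_pow_mul (m : ℕ) (P : MvPolynomial (Fin d) ℝ) :
    restrictToSphere d (normSq d ^ m * P) = restrictToSphere d P := by
  ext x
  simp only [restrictToSphere_apply, map_mul, map_pow]
  have : eval (fun i => x.1 i) (normSq d) = 1 := by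
    simpa [normSq] using sum_sq_coord x
  rw [this, one_pow, one_mul]

theorem restrictToSphere_linForm (x y : UnitSphere d) :
    restrictToSphere d (linForm fun i => y.1 i) x = inner ℝ x.1 y.1 := by
  rw [restrictToSphere_apply]
  simp [linForm, PiLp.inner_apply]

theorem sphereInt_mul_congr {P P' Q Q' : MvPolynomial (Fin d) ℝ}
    (hP : restrictToSphere d P = restrictToSphere d P')
    (hQ : restrictToSphere d Q = restrictToSphere d Q') :
    sphereInt d (P * Q) = sphereInt d (P' * Q') := by
  rw [sphereInt_apply, sphereInt_apply, restrictToSphere_mul, restrictToSphere_mul, hP, hQ]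

theorem sphereInt_mul_eq_zero_of_harmonic_of_lt (hd : 3 ≤ d) {k l : ℕ}
    {P Q : MvPolynomial (Fin d) ℝ} (hP : P.IsHomogeneous k) (hQ : Q.IsHomogeneous l)
    (hQΔ : polyLaplacian d Q = 0) (hkl : k < l) : sphereInt d (P * Q) = 0 :=
  map_mul_eq_zero_of_harmonic hd
    (fun k P hP => mul_sphereInt_eq_sphereInt_polyLaplacian (by omega) k P hP) hP hQ hQΔ hkl

theorem sphereInt_mul_eq_zero_of_harmonic (hd : 3 ≤ d) {k l : ℕ} {P Q : MvPolynomial (Fin d) ℝ}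
    (hP : P.IsHomogeneous k) (hPΔ : polyLaplacian d P = 0) (hQ : Q.IsHomogeneous l)
    (hQΔ : polyLaplacian d Q = 0) (hkl : k ≠ l) : sphereInt d (P * Q) = 0 := by
  obtain h | h := lt_or_gt_of_ne hkl
  · exact sphereInt_mul_eq_zero_of_harmonic_of_lt hd hP hQ hQΔ h
  · rw [mul_comm]
    exact sphereInt_mul_eq_zero_of_harmonic_of_lt hd hQ hP hPΔ h

section Basis

variable {Y : (l : ℕ) → Fin (harmonicDim d l) → UnitSphere d → ℝ}

theorem exists_harmonic_polynomial (hY : ∀ l, IsHarmonicONB d l (Y l)) (l : ℕ)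
    (i : Fin (harmonicDim d l)) : ∃ P : MvPolynomial (Fin d) ℝ, P.IsHomogeneous l ∧
      polyLaplacian d P = 0 ∧ restrictToSphere d P = Y l i := by
  have h : Y l i ∈ sphericalHarmonics d l := by
    rw [← (hY l).span_eq]
    exact Submodule.subset_span ⟨i, rfl⟩
  obtain ⟨P, ⟨h1, h2⟩, h3⟩ := h
  exact ⟨P, h1, h2, h3⟩

/-- Expansion of a homogeneous polynomial of degree `n` on the sphere in spherical harmonics of
degrees `n, n - 2, …`. -/
theorem restrictToSphere_eq_sum (hd : 3 ≤ d) (hY : ∀ l, IsHarmonicONB d l (Y l))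
    {P : (l : ℕ) → Fin (harmonicDim d l) → MvPolynomial (Fin d) ℝ}
    (hP : ∀ l i, (P l i).IsHomogeneous l) (hPΔ : ∀ l i, polyLaplacian d (P l i) = 0)
    (hPY : ∀ l i, restrictToSphere d (P l i) = Y l i)
    {n : ℕ} {Q : MvPolynomial (Fin d) ℝ} (hQ : Q.IsHomogeneous n) :
    restrictToSphere d Q = ∑ m ∈ range (n / 2 + 1), ∑ i,
      sphereInt d (Q * P (n - 2 * m) i) • Y (n - 2 * m) i := by
  have hmem := hQ.mem_span_normSq_pow_mul (by omega)
  clear hQ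
  induction hmem using Submodule.span_induction with
  | zero => simp
  | add Q R _ _ hQ hR =>
    simp only [map_add, add_mul, add_smul, Finset.sum_add_distrib]
    rw [← hQ, ← hR]
  | smul a Q _ hQ =>
    simp only [map_smul, smul_mul_assoc, smul_assoc, ← Finset.smul_sum]
    rw [← hQ]
  | mem Q hQ =>
    obtain ⟨m, k, H, hk, hH, hHΔ, rfl⟩ := hQ
    have hHmem : restrictToSphere d H ∈ sphericalHarmonics d k := ⟨H, ⟨hH, hHΔ⟩, rfl⟩
    rw [← (hY k).span_eq, Submodule.mem_span_range_iff_exists_fun] at hHmem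
    obtain ⟨c, hc⟩ := hHmem
    have hr : restrictToSphere d (normSq d ^ m * H) = restrictToSphere d (∑ j, c j • P k j) := by
      rw [restrictToSphere_normSq_pow_mul, ← hc, map_sum]
      exact Finset.sum_congr rfl fun j _ => by rw [map_smul, hPY]
    have hJ : ∀ l i, sphereInt d (normSq d ^ m * H * P l i)
        = ∑ j, c j * sphereInt d (P k j * P l i) := fun l i => by
      rw [sphereInt_mul_congr hr rfl, Finset.sum_mul, map_sum]
      exact Finset.sum_congr rfl fun j _ => by rw [smul_mul_assoc, map_smul, smul_eq_mul]
    -- On the sphere `|x|^(2m) H` equals `H`, harmonic of degree `n - 2m`, so orthogonality leaves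
    -- only this index.
    rw [Finset.sum_eq_single m]
    · obtain rfl : k = n - 2 * m := by omega
      rw [restrictToSphere_normSq_pow_mul, ← hc]
      refine Finset.sum_congr rfl fun i _ => ?_
      rw [hJ, Finset.sum_eq_single i]
      · have := (hY (n - 2 * m)).orthonormal i i
        rw [if_pos rfl] at this
        rw [sphereInt_apply, restrictToSphere_mul, hPY]
        simp only [Pi.mul_apply]
        rw [this, mul_one]
      · intro j _ hji
        have := (hY (n - 2 * m)).orthonormal j i
        rw [if_neg hji] at this
        rw [sphereInt_apply, restrictToSphere_mul, hPY, hPY]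
        simp only [Pi.mul_apply]
        rw [this, mul_zero]
      · simp
    · intro m' hm' hne
      rw [Finset.mem_range] at hm'
      refine Finset.sum_eq_zero fun i _ => ?_
      rw [hJ, Finset.sum_eq_zero, zero_smul]
      intro j _
      rw [sphereInt_mul_eq_zero_of_harmonic hd (hP _ _) (hPΔ _ _) (hP _ _) (hPΔ _ _) (by omega),
        mul_zero]
    · intro h
      rw [Finset.mem_range] at h
      omega

/-- Expansion of the powers of `⟨x, y⟩` in the reproducing kernels of spherical harmonics. -/
theorem inner_pow_eq_sum (hd : 3 ≤ d) (hY : ∀ l, IsHarmonicONB d l (Y l)) (x y : UnitSphere d)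
    (n : ℕ) : (inner ℝ x.1 y.1) ^ n = ∑ m ∈ range (n / 2 + 1),
      zonalCoeff d (n - 2 * m) m * ∑ i, Y (n - 2 * m) i x * Y (n - 2 * m) i y := by
  choose P hP hPΔ hPY using exists_harmonic_polynomial hY
  have hL : (linForm (fun i => y.1 i) ^ n).IsHomogeneous n := by
    simpa using (isHomogeneous_linForm _).pow n
  have h := congrFun (restrictToSphere_eq_sum hd hY hP hPΔ hPY hL) x
  have h1 : restrictToSphere d (linForm (fun i => y.1 i) ^ n) x = (inner ℝ x.1 y.1) ^ n := by
    rw [← restrictToSphere_linForm, restrictToSphere_apply, restrictToSphere_apply, map_pow]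
  rw [← h1, h]
  simp only [Finset.sum_apply, Pi.smul_apply, smul_eq_mul, Finset.mul_sum]
  refine Finset.sum_congr rfl fun m hm => Finset.sum_congr rfl fun i _ => ?_
  rw [Finset.mem_range] at hm
  rw [map_linForm_pow_mul hd
    (fun k P hP => mul_sphereInt_eq_sphereInt_polyLaplacian (by omega) k P hP)
    (sphereInt_one (by omega)) (sum_sq_coord y) (show n - 2 * m + 2 * m = n by omega)
    (hP _ i) (hPΔ _ i), ← restrictToSphere_apply, hPY]
  ring

/-- Termwise `|Z_l(x, y)| ≤ (Z_l(x, x) + Z_l(y, y)) / 2`, and the expansion of `⟨x, x⟩ ^ n = 1` sums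
the diagonal terms exactly. Pointwise bounds on the harmonics are not needed. -/
theorem sum_zonalCoeff_mul_abs_le_one (hd : 3 ≤ d) (hY : ∀ l, IsHarmonicONB d l (Y l))
    (x y : UnitSphere d) (n : ℕ) : ∑ m ∈ range (n / 2 + 1),
      zonalCoeff d (n - 2 * m) m * |∑ i, Y (n - 2 * m) i x * Y (n - 2 * m) i y| ≤ 1 := by
  have hx := inner_pow_eq_sum hd hY x x n
  have hy := inner_pow_eq_sum hd hY y y n
  rw [real_inner_self_eq_norm_sq, norm_eq_of_mem_sphere, one_pow, one_pow] at hx hy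
  have key : ∀ l, |∑ i, Y l i x * Y l i y|
      ≤ ((∑ i, Y l i x * Y l i x) + ∑ i, Y l i y * Y l i y) / 2 := fun l => by
    refine (Finset.abs_sum_le_sum_abs _ _).trans ?_
    rw [← Finset.sum_add_distrib, Finset.sum_div]
    refine Finset.sum_le_sum fun i _ => ?_
    rw [abs_le]
    constructor <;> nlinarith [sq_nonneg (Y l i x - Y l i y), sq_nonneg (Y l i x + Y l i y)]
  calc _ ≤ ∑ m ∈ range (n / 2 + 1), zonalCoeff d (n - 2 * m) m *
        (((∑ i, Y (n - 2 * m) i x * Y (n - 2 * m) i x)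
          + ∑ i, Y (n - 2 * m) i y * Y (n - 2 * m) i y) / 2) :=
        Finset.sum_le_sum fun m _ =>
          mul_le_mul_of_nonneg_left (key _) (zonalCoeff_pos hd _ _).le
    _ = (1 + 1) / 2 := by
        nth_rw 1 [hx]
        rw [hy, ← Finset.sum_add_distrib, Finset.sum_div]
        exact Finset.sum_congr rfl fun m _ => by ring
    _ = 1 := by norm_num

end Basis

/-! ### Rearrangement of the double series and convergence of the coefficients. -/

section Series

/-- Rearrangement of a series of finite sums over `l + 2 * m = n` into a double series. -/
theorem hasSum_prod_of_hasSum_range {F : ℕ → ℕ → ℝ} {s : ℝ}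
    (habs : Summable fun n => ∑ m ∈ range (n / 2 + 1), |F (n - 2 * m) m|)
    (hsum : HasSum (fun n => ∑ m ∈ range (n / 2 + 1), F (n - 2 * m) m) s) :
    HasSum (fun p : ℕ × ℕ => F p.1 p.2) s := by
  -- `G` is `F` transported along `(l, m) ↦ (l + 2m, m)` and extended by zero off the image.
  let G : ℕ × ℕ → ℝ := fun p => if p.2 ∈ range (p.1 / 2 + 1) then F (p.1 - 2 * p.2) p.2 else 0
  have hsupp : ∀ n, ∀ m ∉ range (n / 2 + 1), G (n, m) = 0 := fun n m hm => if_neg hm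
  have hfib : ∀ n, HasSum (fun m => G (n, m)) (∑ m ∈ range (n / 2 + 1), F (n - 2 * m) m) := fun n => by
    have : HasSum (fun m => G (n, m)) (∑ m ∈ range (n / 2 + 1), G (n, m)) :=
      hasSum_sum_of_ne_finset_zero (hsupp n)
    rwa [Finset.sum_congr rfl fun m hm => if_pos hm] at this
  have hfib' : ∀ n, HasSum (fun m => |G (n, m)|) (∑ m ∈ range (n / 2 + 1), |F (n - 2 * m) m|) :=
    fun n => by
      have : HasSum (fun m => |G (n, m)|) (∑ m ∈ range (n / 2 + 1), |G (n, m)|) :=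
        hasSum_sum_of_ne_finset_zero fun m hm => by rw [hsupp n m hm, abs_zero]
      rwa [Finset.sum_congr rfl fun m hm => congrArg abs (if_pos hm)] at this
  have hG : Summable G := by
    refine Summable.of_abs ((summable_prod_of_nonneg fun p => abs_nonneg _).2
      ⟨fun n => (hfib' n).summable, ?_⟩)
    simpa only [(hfib' _).tsum_eq] using habs
  have hGs : HasSum G s := by
    rw [← (hG.hasSum.prod_fiberwise hfib).unique hsum]
    exact hG.hasSum
  have hinj : Function.Injective fun p : ℕ × ℕ => (p.1 + 2 * p.2, p.2) := by
    rintro ⟨a, b⟩ ⟨a', b'⟩ h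
    simp only [Prod.mk.injEq] at h ⊢
    omega
  rw [← hinj.hasSum_iff] at hGs
  · convert! hGs using 2 with p
    have hp : p.2 ∈ range ((p.1 + 2 * p.2) / 2 + 1) := by
      rw [Finset.mem_range]
      omega
    simp only [Function.comp_apply, G]
    rw [if_pos hp, Nat.add_sub_cancel]
  · rintro ⟨n, m⟩ h
    refine hsupp n m fun hm => h ⟨(n - 2 * m, m), ?_⟩
    rw [Finset.mem_range] at hm
    simp only [Prod.mk.injEq, and_true]
    omega

variable {h : ℝ → ℝ}

theorem half_sub_two_mul_betaTerm (l m : ℕ) :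
    ((d : ℝ) - 2) / 2 * betaTerm d h l m
      = iteratedDeriv (l + 2 * m) h 0 / (Nat.factorial (l + 2 * m) : ℝ) * zonalCoeff d l m := by
  have : (Nat.factorial (l + 2 * m) : ℝ) ≠ 0 := by positivity
  unfold betaTerm zonalCoeff
  field_simp

theorem summable_abs_coeff (hh : AnalyticOnUnitInterval h) :
    Summable fun n : ℕ => |iteratedDeriv n h 0 / (Nat.factorial n : ℝ)| := by
  -- At `x = 1` the terms are the coefficients themselves, and real summability is absolute.
  simpa using (hh 1 (by simp)).summable.abs

theorem summable_betaTerm (hd : 3 ≤ d) (hh : AnalyticOnUnitInterval h) (l : ℕ) :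
    Summable (betaTerm d h l) := by
  rw [← summable_mul_left_iff (half_sub_two_pos hd).ne']
  have hinj : Function.Injective fun m : ℕ => l + 2 * m := fun a b hab => by
    simp only at hab
    omega
  refine Summable.of_norm_bounded ((summable_abs_coeff hh).comp_injective hinj) fun m => ?_
  rw [half_sub_two_mul_betaTerm, Real.norm_eq_abs, abs_mul, abs_of_pos (zonalCoeff_pos hd l m)]
  exact mul_le_of_le_one_right (abs_nonneg _) (zonalCoeff_le_one hd l m)

end Series

end SphereExpansion

theorem mainTheorem3 (d : ℕ) (hd : 3 ≤ d) (h : ℝ → ℝ) (hh : AnalyticOnUnitInterval h)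
    (K : UnitSphere d → UnitSphere d → ℝ)
    (hK : ∀ x y : UnitSphere d,
      K x y = h (inner ℝ (x : EuclideanSpace ℝ (Fin d)) (y : EuclideanSpace ℝ (Fin d))))
    (Y : (l : ℕ) → Fin (harmonicDim d l) → UnitSphere d → ℝ)
    (hY : ∀ l : ℕ, IsHarmonicONB d l (Y l)) :
    (∀ l : ℕ, Summable (betaTerm d h l)) ∧
      ∀ x y : UnitSphere d,
        HasSum (fun l : ℕ => beta d h l * ∑ i : Fin (harmonicDim d l), Y l i x * Y l i y)
          (K x y) := by
  refine ⟨summable_betaTerm hd hh, fun x y => ?_⟩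
  let a : ℕ → ℝ := fun n => iteratedDeriv n h 0 / (Nat.factorial n : ℝ)
  let Z : ℕ → ℝ := fun l => ∑ i : Fin (harmonicDim d l), Y l i x * Y l i y
  let F : ℕ → ℕ → ℝ := fun l m => a (l + 2 * m) * zonalCoeff d l m * Z l
  have hF : ∀ n, ∀ m ∈ range (n / 2 + 1),
      F (n - 2 * m) m = a n * (zonalCoeff d (n - 2 * m) m * Z (n - 2 * m)) := fun n m hm => by
    rw [Finset.mem_range] at hm
    simp only [F]
    rw [show n - 2 * m + 2 * m = n by omega, mul_assoc]
  have habs : Summable fun n => ∑ m ∈ range (n / 2 + 1), |F (n - 2 * m) m| := by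
    refine Summable.of_nonneg_of_le (fun n => Finset.sum_nonneg fun _ _ => abs_nonneg _)
      (fun n => ?_) (summable_abs_coeff hh)
    calc ∑ m ∈ range (n / 2 + 1), |F (n - 2 * m) m|
        = |a n| * ∑ m ∈ range (n / 2 + 1), zonalCoeff d (n - 2 * m) m * |Z (n - 2 * m)| := by
          rw [Finset.mul_sum]
          refine Finset.sum_congr rfl fun m hm => ?_
          rw [hF n m hm, abs_mul, abs_mul, abs_of_pos (zonalCoeff_pos hd _ _)]
      _ ≤ |a n| := mul_le_of_le_one_right (abs_nonneg _) (sum_zonalCoeff_mul_abs_le_one hd hY x y n)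
  have hsum : HasSum (fun n => ∑ m ∈ range (n / 2 + 1), F (n - 2 * m) m) (K x y) := by
    have hmem : inner ℝ x.1 y.1 ∈ Set.Icc (-1 : ℝ) 1 := by
      have := abs_real_inner_le_norm x.1 y.1
      rw [norm_eq_of_mem_sphere, norm_eq_of_mem_sphere, one_mul, abs_le] at this
      exact this
    rw [hK]
    convert! hh _ hmem using 2 with n
    rw [inner_pow_eq_sum hd hY x y n, Finset.mul_sum]
    exact Finset.sum_congr rfl fun m hm => hF n m hm
  -- For fixed `l`, the sum over `m` is `β_l(h) Z_l(x, y)`.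
  refine (hasSum_prod_of_hasSum_range habs hsum).prod_fiberwise fun l => ?_
  have hl := ((summable_betaTerm hd hh l).hasSum.mul_left (((d : ℝ) - 2) / 2)).mul_right (Z l)
  simp only [half_sub_two_mul_betaTerm] at hl
  exact hl
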